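/- Let $m\ge 1$ and $n_Q\ge 0$ be integers and $n=n_Qm$. Let $\mathcal X$ be a set of inputs and, for every $x\in\mathcal X$, let $U_{\rm enc}(x)$ be a unitary operator on $n$ qubits, with encoded state $|\psi(x)\rangle=U_{\rm enc}(x)|0\rangle^{\otimes n}$. Let $\mathcal O$ be a traceless Hermitian operator on $m$ qubits and put $O=\sum_{k=1}^{n_Q} I_{(k-1)m}\otimes\mathcal O\otimes I_{(n_Q-k)m}$, where $I_u$ is the identity on $u$ qubits. For $i=1,2,\dots$ let $U_i=U_i^1\otimes\cdots\otimes U_i^{n_Q}$, where all the random unitaries $U_i^k\in U(2^m)$ are independent and the law of each $U_i^k$ is a unitary 2-design (a probability measure on $U(2^m)$ whose moments of degree two in the entries of $U$ and degree two in their complex conjugates agree with those of Haar measure; the design may depend on $i$ and $k$). Define the quantum features $f^Q(x)_i=\langle\psi(x)|U_i^\dagger O U_i|\psi(x)\rangle$, $i=1,\dots,n_0$. They are the input of a fully connected classical network with $L$ layers of widths $n_0,n_1,\dots,n_L$, with $n_L=1$, and with Lipschitz activation function $\sigma$: $$\alpha^{(0)}(x)=f^Q(x),\qquad \tilde\alpha^{(\ell+1)}(x)=\tfrac{1}{\sqrt{n_\ell}}W^{(\ell)}\alpha^{(\ell)}(x)+\xi\,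 b^{(\ell)},\qquad \alpha^{(\ell)}(x)=\sigma(\tilde\alpha^{(\ell)}(x))\ (\ell\ge 1),$$ where $\xi\in\mathbb R$, all entries of the $W^{(\ell)}$ and $b^{(\ell)}$ are independent standard normal variables that are independent of the $U_i^k$, and the output of the network at initialization is $f(x)=\tilde\alpha^{(L)}(x)$ (no activation is applied to the last layer). Then for $L=1$, as $n_0\to\infty$, the output function $f$ converges, in the sense of weak convergence of finite-dimensional distributions over inputs $x\in\mathcal X$, to a centered Gaussian process on $\mathcal X$ with covariance function $$\Sigma_Q^{(1)}(x,x')=\frac{\operatorname{Tr}(\mathcal O^2)}{2^{2m}-1}\sum_{k=1}^{n_Q}\left(\operatorname{Tr}(\rho_x^k\rho_{x'}^k)-\frac1{2^m}\right)+\xi^2 .$$ Here $\rho_x^k$ is the reduced density matrix of the encoded state on the $k$-th block of $m$ qubits, namely the partial trace of $U_{\rm enc}(x)|0\rangle^{\otimes n}\langle 0|^{\otimes n}U_{\rm enc}(x)^\dagger$ over all qubits except those numbered $(k-1)m,\dots,km-1$ (qubits are numbered from $0$). -/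

import Mathlib

open MeasureTheory ProbabilityTheory Filter
open scoped Matrix

namespace QCNN

noncomputable section

/-! ### The unitary group, Haar measure and unitary 2-designs -/

section UnitaryGroup

variable {d : Type} [Fintype d] [DecidableEq d]

/-- The unitary group carries its Borel σ-algebra. -/
instance instMeasurableSpaceUnitaryGroup : MeasurableSpace (Matrix.unitaryGroup d ℂ) := borel _

instance instBorelSpaceUnitaryGroup : BorelSpace (Matrix.unitaryGroup d ℂ) := ⟨rfl⟩

instance instCompactSpaceUnitaryGroup : CompactSpace (Matrix.unitaryGroup d ℂ) := by
  have hK : IsCompact (Set.pi Set.univ (fun _ : d => Set.pi Set.univ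
      (fun _ : d => Metric.closedBall (0 : ℂ) 1))) :=
    isCompact_univ_pi fun _ => isCompact_univ_pi fun _ => isCompact_closedBall 0 1
  refine isCompact_iff_compactSpace.mp
    (IsCompact.of_isClosed_subset (X := Matrix d d ℂ) hK isClosed_unitary ?_)
  intro U hU i _ j _
  simpa using entry_norm_bound_of_unitary hU i j

/-- The normalized Haar measure of the unitary group `U(d)`. -/
def haarUnitary (d : Type) [Fintype d] [DecidableEq d] : Measure (Matrix.unitaryGroup d ℂ) :=
  Measure.haarMeasure ⊤

/-- A probability measure on `U(d)` is a unitary 2-design if all its moments of degree two in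
the entries of `U` and degree two in their complex conjugates agree with those of the
Haar measure. -/
def IsUnitaryTwoDesign (ν : ProbabilityMeasure (Matrix.unitaryGroup d ℂ)) : Prop :=
  ∀ a₁ b₁ a₂ b₂ c₁ e₁ c₂ e₂ : d,
    ∫ U : Matrix.unitaryGroup d ℂ,
        U.1 a₁ b₁ * U.1 a₂ b₂ * star (U.1 c₁ e₁) * star (U.1 c₂ e₂) ∂(ν : Measure _) =
      ∫ U : Matrix.unitaryGroup d ℂ,
        U.1 a₁ b₁ * U.1 a₂ b₂ * star (U.1 c₁ e₁) * star (U.1 c₂ e₂) ∂(haarUnitary d)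

end UnitaryGroup

/-! ### The quantum part -/

/-- Labels of the computational basis of `n` qubits (bit strings of length `n`). -/
abbrev Bits (n : ℕ) : Type := Fin n → Fin 2

section Quantum

variable {m nQ : ℕ}

/-- The bits of the `k`-th block of `m` consecutive qubits, `k = 0, …, nQ - 1`: these are the
qubits number `k * m, …, k * m + m - 1`. -/
def block (k : Fin nQ) (x : Bits (nQ * m)) : Bits m :=
  fun j => x (finProdFinEquiv (k, j))

/-- The tensor product `V 0 ⊗ V 1 ⊗ ⋯ ⊗ V (nQ - 1)` of operators on the blocks. -/
def tensorBlocks (V : Fin nQ → Matrix (Bits m) (Bits m) ℂ) :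
    Matrix (Bits (nQ * m)) (Bits (nQ * m)) ℂ :=
  Matrix.of fun x y => ∏ k, V k (block k x) (block k y)

/-- The operator `I ⊗ ⋯ ⊗ I ⊗ A ⊗ I ⊗ ⋯ ⊗ I`, with `A` acting on block `k`. -/
def onBlock (k : Fin nQ) (A : Matrix (Bits m) (Bits m) ℂ) :
    Matrix (Bits (nQ * m)) (Bits (nQ * m)) ℂ :=
  tensorBlocks (Function.update (fun _ => 1) k A)

/-- The observable `O`, the sum over all blocks of the local observable `A`. -/
def totalObservable (nQ : ℕ) (A : Matrix (Bits m) (Bits m) ℂ) :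
    Matrix (Bits (nQ * m)) (Bits (nQ * m)) ℂ :=
  ∑ k : Fin nQ, onBlock k A

/-- The vector `|0⟩^{⊗ n}`. -/
def zeroState (n : ℕ) : Bits n → ℂ := Pi.single (fun _ => 0) 1

/-- The encoded state `|ψ⟩ = U_enc |0⟩^{⊗ n}`. -/
def encodedState {n : ℕ} (Uenc : Matrix.unitaryGroup (Bits n) ℂ) : Bits n → ℂ :=
  Uenc.1 *ᵥ zeroState n

/-- The density matrix `U_enc |0⟩⟨0| U_enc†` of the encoded state. -/
def encodedDensity {n : ℕ} (Uenc : Matrix.unitaryGroup (Bits n) ℂ) : Matrix (Bits n) (Bits n) ℂ :=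
  Uenc.1 * Matrix.vecMulVec (zeroState n) (star (zeroState n)) * Uenc.1ᴴ

/-- The partial trace over all qubits outside block `k`. -/
def partialTraceBlock (k : Fin nQ) (ρ : Matrix (Bits (nQ * m)) (Bits (nQ * m)) ℂ) :
    Matrix (Bits m) (Bits m) ℂ :=
  Matrix.of fun a b => ∑ x, ∑ y,
    if block k x = a ∧ block k y = b ∧ ∀ r, r ≠ k → block r x = block r y then ρ x y else 0

/-- The reduced density matrix `ρ^k` of the encoded state on block `k`. -/
def reducedDensity (Uenc : Matrix.unitaryGroup (Bits (nQ * m)) ℂ) (k : Fin nQ) :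
    Matrix (Bits m) (Bits m) ℂ :=
  partialTraceBlock k (encodedDensity Uenc)

/-- The feature `⟨ψ| U† O U |ψ⟩`, where `U = U¹ ⊗ ⋯ ⊗ U^{nQ}` and `O` is the sum of the local
observables `A`. For Hermitian `A` this number is real. -/
def quantumFeature (A : Matrix (Bits m) (Bits m) ℂ)
    (Uenc : Matrix.unitaryGroup (Bits (nQ * m)) ℂ)
    (U : Fin nQ → Matrix.unitaryGroup (Bits m) ℂ) : ℝ :=
  (star (encodedState Uenc) ⬝ᵥ
    (((tensorBlocks fun k => (U k).1)ᴴ * totalObservable nQ A * tensorBlocks fun k => (U k).1) *ᵥ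
      encodedState Uenc)).re

/-- The covariance function
`Tr(A²) / (2^{2m} - 1) * ∑ₖ (Tr(ρₓᵏ ρₓ'ᵏ) - 2^{-m}) + ξ²`. -/
def covarianceKernel {X : Type*} (A : Matrix (Bits m) (Bits m) ℂ)
    (Uenc : X → Matrix.unitaryGroup (Bits (nQ * m)) ℂ) (ξ : ℝ) (x x' : X) : ℝ :=
  (A * A).trace.re / (2 ^ (2 * m) - 1) *
    ∑ k : Fin nQ,
      ((reducedDensity (Uenc x) k * reducedDensity (Uenc x') k).trace.re - 1 / 2 ^ m) + ξ ^ 2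

end Quantum

/-! ### The classical part: a fully connected network with `L` layers -/

section Classical

variable {L : ℕ}

/-- Weight matrices `W⁽⁰⁾, …, W⁽ᴸ⁻¹⁾` for layer widths `w 0, …, w L`. -/
abbrev Weights (w : Fin (L + 1) → ℕ) : Type :=
  (ℓ : Fin L) → Fin (w ℓ.succ) → Fin (w ℓ.castSucc) → ℝ

/-- Bias vectors `b⁽⁰⁾, …, b⁽ᴸ⁻¹⁾`. -/
abbrev Biases (w : Fin (L + 1) → ℕ) : Type :=
  (ℓ : Fin L) → Fin (w ℓ.succ) → ℝ

/-- One affine step `a ↦ W a / √q + ξ b`, where `q` is the number of inputs. -/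
def affineStep {p q : ℕ} (ξ : ℝ) (W : Fin p → Fin q → ℝ) (b : Fin p → ℝ) (a : Fin q → ℝ) :
    Fin p → ℝ :=
  fun j => 1 / √(q : ℝ) * ∑ i, W j i * a i + ξ * b j

/-- The activations `α⁽⁰⁾ = v` and `α⁽ℓ⁺¹⁾ = σ(W⁽ℓ⁾ α⁽ℓ⁾ / √n_ℓ + ξ b⁽ℓ⁾)`. -/
def activation (w : Fin (L + 1) → ℕ) (σ : ℝ → ℝ) (ξ : ℝ) (W : Weights w) (b : Biases w)
    (v : Fin (w 0) → ℝ) (ℓ : Fin (L + 1)) : Fin (w ℓ) → ℝ :=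
  Fin.induction (motive := fun ℓ => Fin (w ℓ) → ℝ) v
    (fun ℓ a j => σ (affineStep ξ (W ℓ) (b ℓ) a j)) ℓ

/-- The pre-activation `W⁽ℓ⁾ α⁽ℓ⁾ / √n_ℓ + ξ b⁽ℓ⁾` of layer `ℓ + 1`. -/
def preActivation (w : Fin (L + 1) → ℕ) (σ : ℝ → ℝ) (ξ : ℝ) (W : Weights w) (b : Biases w)
    (v : Fin (w 0) → ℝ) (ℓ : Fin L) : Fin (w ℓ.succ) → ℝ :=
  affineStep ξ (W ℓ) (b ℓ) (activation w σ ξ W b v ℓ.castSucc)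

/-- The output of the network with `L + 1` layers: the pre-activation of the last layer (no
activation function is applied to the output). -/
def networkOutput (w : Fin (L + 1 + 1) → ℕ) (σ : ℝ → ℝ) (ξ : ℝ) (W : Weights w) (b : Biases w)
    (v : Fin (w 0) → ℝ) : Fin (w (Fin.last (L + 1))) → ℝ :=
  preActivation w σ ξ W b v (Fin.last L)

end Classical

/-! ### The quantum-classical network at initialization -/

section Model

variable {m nQ L : ℕ}

/-- All random quantities at initialization: the local unitaries `U i k` of the circuits
`i = 0, …, w 0 - 1`, the weights and the biases. -/
abbrev Init (m nQ : ℕ) (w : Fin (L + 1) → ℕ) : Type :=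
  (Fin (w 0) → Fin nQ → Matrix.unitaryGroup (Bits m) ℂ) × (Weights w × Biases w)

/-- The law of the initialization: all local unitaries, weights and biases are independent,
`U i k` has law `ν i k`, and all weights and biases are standard normal. -/
def initLaw (w : Fin (L + 1) → ℕ)
    (ν : ℕ → Fin nQ → ProbabilityMeasure (Matrix.unitaryGroup (Bits m) ℂ)) :
    Measure (Init m nQ w) :=
  (Measure.pi fun i : Fin (w 0) => Measure.pi fun k : Fin nQ => (ν i k : Measure _)).prod
    ((Measure.pi fun _ => Measure.pi fun _ => Measure.pi fun _ => gaussianReal 0 1).prod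
      (Measure.pi fun _ => Measure.pi fun _ => gaussianReal 0 1))

instance instIsProbabilityMeasureInitLaw (w : Fin (L + 1) → ℕ)
    (ν : ℕ → Fin nQ → ProbabilityMeasure (Matrix.unitaryGroup (Bits m) ℂ)) :
    IsProbabilityMeasure (initLaw w ν) := by
  unfold initLaw
  infer_instance

/-- The output, at input `x` and random initialization `ω`, of the quantum-classical network with
`L + 1` classical layers, whose input vector consists of the `w 0` quantum features of `x`. -/
def output {X : Type*} (w : Fin (L + 1 + 1) → ℕ) (σ : ℝ → ℝ) (ξ : ℝ)
    (A : Matrix (Bits m) (Bits m) ℂ) (Uenc : X → Matrix.unitaryGroup (Bits (nQ * m)) ℂ)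
    (x : X) (ω : Init m nQ w) : Fin (w (Fin.last (L + 1))) → ℝ :=
  networkOutput w σ ξ ω.2.1 ω.2.2 fun i => quantumFeature A (Uenc x) (ω.1 i)

end Model

/-! ### Convergence to a centered Gaussian process -/

/-- The real processes `f N`, indexed by `X`, converge for `N → ∞` to a centered Gaussian process
with covariance function `S`: such a process exists, and the finite-dimensional distributions of
`f N` converge weakly to those of this process. -/
def ConvergesToCenteredGaussianProcess {X : Type*} {Ω : ℕ → Type*} [∀ N, MeasurableSpace (Ω N)]
    (f : (N : ℕ) → X → Ω N → ℝ) (P : (N : ℕ) → Measure (Ω N)) [∀ N, IsProbabilityMeasure (P N)]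
    (S : X → X → ℝ) : Prop :=
  ∃ (Ω' : Type) (_ : MeasurableSpace Ω') (P' : Measure Ω') (_ : IsProbabilityMeasure P')
    (Z : X → Ω' → ℝ),
    IsGaussianProcess Z P' ∧
    (∀ x, ∫ ω, Z x ω ∂P' = 0) ∧
    (∀ x x', cov[Z x, Z x'; P'] = S x x') ∧
    ∀ I : Finset X,
      TendstoInDistribution (fun N ω => I.restrict (fun x => f N x ω)) atTop
        (fun ω => I.restrict (fun x => Z x ω)) P P'

end

end QCNN

/-! Fix the unitaries. A one-layer output is then a linear form in the standard normal weights and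
bias, so the characteristic function of `∑ t x * f x` is the mean over the unitaries of `exp (-(S +
(ξ ∑ t)²) / 2)`, where `S` is the average of `q(U_i)²` and `q = ∑ t x * quantumFeature x`
(`integral_exp_output`). No central limit theorem is needed: it suffices that `S` concentrates.

The variables `q(U_i)²` are independent and bounded, since the unitary group is compact. Their laws
may depend on `i`, but their mean does not: it is a moment of degree (2, 2), which every 2-design
shares with Haar measure. A weak law of large numbers replaces `S` by this mean
(`tendsto_integral_exp_neg_mean`).

For the mean, a feature is a sum over blocks of `Tr(ρ^k U_k† A U_k)`. The blocks are independent and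
centered, so second moments add, and each follows from unitary invariance
(`integral_haarUnitary_conjTrace_sq`). The result is the kernel without its bias term
(`integral_sq_sum_quantumFeature`).

The limit process exists because the kernel is a Gram matrix of vectors in a finite-dimensional
space (`inner_covarianceFeature`): pair these with one standard Gaussian vector. -/

namespace QCNN

noncomputable section

/-! ### First and second moments of `Tr(X U† A U)` under Haar measure and 2-designs. -/

section UnitaryMoments

variable {d : Type} [Fintype d] [DecidableEq d]

lemma integrable_of_continuous_unitaryGroup {E : Type*} [NormedAddCommGroup E]
    {μ : Measure (Matrix.unitaryGroup d ℂ)} [IsFiniteMeasure μ]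
    {f : Matrix.unitaryGroup d ℂ → E} (hf : Continuous f) : Integrable f μ :=
  hf.integrable_of_hasCompactSupport (HasCompactSupport.of_compactSpace f)

instance instIsHaarMeasureHaarUnitary : (haarUnitary d).IsHaarMeasure := by
  unfold haarUnitary; infer_instance

instance instIsProbabilityMeasureHaarUnitary : IsProbabilityMeasure (haarUnitary d) :=
  ⟨by simpa [haarUnitary] using Measure.haarMeasure_self (K₀ := (⊤ : TopologicalSpace.PositiveCompacts
    (Matrix.unitaryGroup d ℂ)))⟩

/-- The Haar measure of the compact group `U(d)` is invariant under right translations. -/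
lemma integral_haarUnitary_mul_right (f : Matrix.unitaryGroup d ℂ → ℂ)
    (V : Matrix.unitaryGroup d ℂ) :
    ∫ U, f (U * V) ∂(haarUnitary d) = ∫ U, f U ∂(haarUnitary d) := by
  have : IsProbabilityMeasure ((haarUnitary d).map (· * V)) :=
    Measure.isProbabilityMeasure_map (by fun_prop)
  -- Right translation commutes with left translations, so the pushforward is again a left Haar
  -- probability measure and uniqueness applies.
  have : ((haarUnitary d).map (· * V)).IsHaarMeasure := inferInstance
  have h : (haarUnitary d).map (· * V) = haarUnitary d :=
    Measure.isHaarMeasure_eq_of_isProbabilityMeasure _ _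
  conv_rhs => rw [← h]
  exact ((Homeomorph.mulRight V).isClosedEmbedding.measurableEmbedding.integral_map f).symm

/-- The function `U ↦ Tr(X U† A U)`. -/
def conjTrace (A X : Matrix d d ℂ) (U : Matrix.unitaryGroup d ℂ) : ℂ :=
  (X * (star U.1 * A * U.1)).trace

lemma continuous_conjTrace (A X : Matrix d d ℂ) : Continuous (conjTrace A X) := by
  unfold conjTrace
  fun_prop

lemma conjTrace_mul_right (A X : Matrix d d ℂ) (U V : Matrix.unitaryGroup d ℂ) :
    conjTrace A X (U * V) = conjTrace A (V.1 * X * star V.1) U := by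
  simp only [conjTrace, Submonoid.coe_mul, star_mul]
  rw [← mul_assoc, ← mul_assoc, Matrix.trace_mul_comm]
  simp only [mul_assoc]

lemma conjTrace_add (A X Y : Matrix d d ℂ) (U : Matrix.unitaryGroup d ℂ) :
    conjTrace A (X + Y) U = conjTrace A X U + conjTrace A Y U := by
  simp [conjTrace, add_mul]

lemma conjTrace_smul (A X : Matrix d d ℂ) (c : ℂ) (U : Matrix.unitaryGroup d ℂ) :
    conjTrace A (c • X) U = c * conjTrace A X U := by
  simp [conjTrace]

lemma conjTrace_sum {ι : Type*} (s : Finset ι) (A : Matrix d d ℂ) (X : ι → Matrix d d ℂ)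
    (U : Matrix.unitaryGroup d ℂ) :
    conjTrace A (∑ i ∈ s, X i) U = ∑ i ∈ s, conjTrace A (X i) U := by
  simp [conjTrace, Finset.sum_mul]

lemma conjTrace_one_right (A : Matrix d d ℂ) (U : Matrix.unitaryGroup d ℂ) :
    conjTrace A 1 U = A.trace := by
  have h : U.1 * star U.1 = 1 := Unitary.coe_mul_star_self U
  rw [conjTrace, one_mul, mul_assoc, Matrix.trace_mul_comm, mul_assoc, h, mul_one]

lemma conjTrace_one_left (X : Matrix d d ℂ) (U : Matrix.unitaryGroup d ℂ) :
    conjTrace 1 X U = X.trace := by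
  rw [conjTrace, mul_one, Unitary.coe_star_mul_self, mul_one]

/-- Exhibits degree (1, 1) in the entries of `U` and their conjugates, so that products of two such
functions fall under the design condition. -/
lemma conjTrace_eq_sum (A X : Matrix d d ℂ) (U : Matrix.unitaryGroup d ℂ) :
    conjTrace A X U = ∑ p : (d × d) × (d × d),
      X p.1.1 p.1.2 * A p.2.1 p.2.2 * (U.1 p.2.2 p.1.1 * star (U.1 p.2.1 p.1.2)) := by
  simp only [conjTrace, Matrix.trace, Matrix.diag, Matrix.mul_apply, Fintype.sum_prod_type,
    Matrix.star_apply, Finset.sum_mul, Finset.mul_sum]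
  refine Finset.sum_congr rfl fun a _ => Finset.sum_congr rfl fun b _ => ?_
  rw [Finset.sum_comm]
  refine Finset.sum_congr rfl fun c _ => Finset.sum_congr rfl fun e _ => ?_
  ring

/-- The product of two functions `U ↦ Tr(X U† A U)` has the same mean under a unitary 2-design
and under the Haar measure. -/
lemma IsUnitaryTwoDesign.integral_conjTrace_mul
    {ν : ProbabilityMeasure (Matrix.unitaryGroup d ℂ)} (hν : IsUnitaryTwoDesign ν)
    (A X B Y : Matrix d d ℂ) :
    ∫ U, conjTrace A X U * conjTrace B Y U ∂(ν : Measure _) =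
      ∫ U, conjTrace A X U * conjTrace B Y U ∂(haarUnitary d) := by
  have key (U : Matrix.unitaryGroup d ℂ) : conjTrace A X U * conjTrace B Y U =
      ∑ p : (d × d) × (d × d), ∑ q : (d × d) × (d × d),
        (X p.1.1 p.1.2 * A p.2.1 p.2.2 * (Y q.1.1 q.1.2 * B q.2.1 q.2.2)) *
          (U.1 p.2.2 p.1.1 * U.1 q.2.2 q.1.1 * star (U.1 p.2.1 p.1.2) *
            star (U.1 q.2.1 q.1.2)) := by
    rw [conjTrace_eq_sum, conjTrace_eq_sum, Finset.sum_mul_sum]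
    refine Finset.sum_congr rfl fun p _ => Finset.sum_congr rfl fun q _ => ?_
    ring
  have hc (a : d) (b : d) : Continuous fun U : Matrix.unitaryGroup d ℂ => U.1 a b :=
    (continuous_apply_apply a b).comp continuous_subtype_val
  have hint (μ : Measure (Matrix.unitaryGroup d ℂ)) [IsProbabilityMeasure μ]
      (p q : (d × d) × (d × d)) :
      Integrable (fun U : Matrix.unitaryGroup d ℂ =>
        (X p.1.1 p.1.2 * A p.2.1 p.2.2 * (Y q.1.1 q.1.2 * B q.2.1 q.2.2)) *
          (U.1 p.2.2 p.1.1 * U.1 q.2.2 q.1.1 * star (U.1 p.2.1 p.1.2) *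
            star (U.1 q.2.1 q.1.2))) μ := by
    apply integrable_of_continuous_unitaryGroup
    exact continuous_const.mul ((((hc _ _).mul (hc _ _)).mul (hc _ _).star).mul (hc _ _).star)
  simp_rw [key]
  rw [integral_finsetSum _ fun p _ => integrable_finsetSum _ fun q _ => hint _ p q,
    integral_finsetSum _ fun p _ => integrable_finsetSum _ fun q _ => hint _ p q]
  refine Finset.sum_congr rfl fun p _ => ?_
  rw [integral_finsetSum _ fun q _ => hint _ p q, integral_finsetSum _ fun q _ => hint _ p q]
  refine Finset.sum_congr rfl fun q _ => ?_
  rw [integral_const_mul, integral_const_mul, hν]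

/-- The design condition only mentions degree (2, 2). Multiplying by `conjTrace 1 1`, which is the
nonzero constant `Tr 1`, lifts degree (1, 1) to it. -/
lemma IsUnitaryTwoDesign.integral_conjTrace [Nonempty d]
    {ν : ProbabilityMeasure (Matrix.unitaryGroup d ℂ)} (hν : IsUnitaryTwoDesign ν)
    (A X : Matrix d d ℂ) :
    ∫ U, conjTrace A X U ∂(ν : Measure _) = ∫ U, conjTrace A X U ∂(haarUnitary d) := by
  have h := hν.integral_conjTrace_mul A X 1 1
  simp_rw [conjTrace_one_left, integral_mul_const] at h
  refine mul_right_cancel₀ ?_ h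
  simp

/-- The unitary matrix of a permutation. -/
def permUnitary (σ : Equiv.Perm d) : Matrix.unitaryGroup d ℂ :=
  ⟨σ.permMatrix ℂ, by
    rw [Matrix.mem_unitaryGroup_iff, Matrix.star_eq_conjTranspose, Matrix.conjTranspose_permMatrix,
      ← Matrix.permMatrix_mul]
    simp⟩

/-- Turns unitary invariance into symmetry of the diagonal matrix units under relabelling of the
basis. -/
lemma permUnitary_conj_single (σ : Equiv.Perm d) (a : d) :
    (permUnitary σ).1 * Matrix.single (σ a) (σ a) 1 * star (permUnitary σ).1 =
      Matrix.single a a 1 := by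
  simp only [permUnitary, Matrix.star_eq_conjTranspose, Matrix.conjTranspose_permMatrix,
    Equiv.Perm.permMatrix]
  rw [PEquiv.toMatrix_toPEquiv_mul, PEquiv.mul_toMatrix_toPEquiv]
  ext i j
  simp [Matrix.single_apply, Equiv.Perm.inv_def]

lemma integral_haarUnitary_conjTrace_conj (A X : Matrix d d ℂ) (V : Matrix.unitaryGroup d ℂ) :
    ∫ U, conjTrace A (V.1 * X * star V.1) U ∂(haarUnitary d) =
      ∫ U, conjTrace A X U ∂(haarUnitary d) := by
  simp_rw [← conjTrace_mul_right]
  exact integral_haarUnitary_mul_right _ V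

lemma integral_haarUnitary_conjTrace_mul_conj (A X Y : Matrix d d ℂ)
    (V : Matrix.unitaryGroup d ℂ) :
    ∫ U, conjTrace A (V.1 * X * star V.1) U * conjTrace A (V.1 * Y * star V.1) U
        ∂(haarUnitary d) =
      ∫ U, conjTrace A X U * conjTrace A Y U ∂(haarUnitary d) := by
  simp_rw [← conjTrace_mul_right]
  exact integral_haarUnitary_mul_right (fun U => conjTrace A X U * conjTrace A Y U) V

lemma exists_unitary_conj_diagonal {X : Matrix d d ℂ} (hX : X.IsHermitian) :
    ∃ (V : Matrix.unitaryGroup d ℂ) (x : d → ℂ), X = V.1 * Matrix.diagonal x * star V.1 :=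
  ⟨hX.eigenvectorUnitary, _, by
    simpa [Unitary.conjStarAlgAut_apply] using hX.spectral_theorem⟩

lemma diagonal_eq_sum_smul_single (x : d → ℂ) :
    Matrix.diagonal x = ∑ a, x a • Matrix.single a a (1 : ℂ) := by
  rw [← Matrix.sum_single_eq_diagonal]
  simp

/-- Under the Haar measure, `Tr(X U† A U)` has mean zero if `A` is traceless. -/
lemma integral_haarUnitary_conjTrace_eq_zero [Nonempty d] {A X : Matrix d d ℂ} (hA : A.trace = 0)
    (hX : X.IsHermitian) : ∫ U, conjTrace A X U ∂(haarUnitary d) = 0 := by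
  obtain ⟨V, x, rfl⟩ := exists_unitary_conj_diagonal hX
  have hi (a : d) : Integrable (conjTrace A (Matrix.single a a 1)) (haarUnitary d) :=
    integrable_of_continuous_unitaryGroup (continuous_conjTrace _ _)
  -- The diagonal means all agree by symmetry, and they add up to `Tr A = 0`.
  have hperm (a b : d) : ∫ U, conjTrace A (Matrix.single a a 1) U ∂(haarUnitary d) =
      ∫ U, conjTrace A (Matrix.single b b 1) U ∂(haarUnitary d) := by
    have := integral_haarUnitary_conjTrace_conj A
      (Matrix.single (Equiv.swap a b a) (Equiv.swap a b a) 1) (permUnitary (Equiv.swap a b))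
    rwa [permUnitary_conj_single, Equiv.swap_apply_left] at this
  have hzero (a : d) : ∫ U, conjTrace A (Matrix.single a a 1) U ∂(haarUnitary d) = 0 := by
    have h1 : ∑ b, ∫ U, conjTrace A (Matrix.single b b 1) U ∂(haarUnitary d) = 0 := by
      rw [← integral_finsetSum _ fun b _ => hi b]
      simp_rw [← conjTrace_sum, Matrix.sum_single_one, conjTrace_one_right, hA]
      simp
    rw [Finset.sum_congr rfl fun b _ => hperm b a] at h1
    simpa using h1
  rw [integral_haarUnitary_conjTrace_conj, diagonal_eq_sum_smul_single]
  simp_rw [conjTrace_sum, conjTrace_smul]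
  rw [integral_finsetSum _ fun b _ => (hi b).const_mul _]
  simp [integral_const_mul, hzero]

/-- The second moment of `Tr(X U† A U)` under the Haar measure is a quadratic form in `X` that is
determined up to a constant by unitary invariance. -/
lemma exists_integral_haarUnitary_conjTrace_sq [Nontrivial d] {A : Matrix d d ℂ}
    (hA : A.trace = 0) :
    ∃ γ : ℂ, ∀ X : Matrix d d ℂ, X.IsHermitian →
      ∫ U, conjTrace A X U ^ 2 ∂(haarUnitary d) =
        γ * (Fintype.card d * (X * X).trace - X.trace ^ 2) := by
  let E (a : d) : Matrix d d ℂ := Matrix.single a a 1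
  -- Permutation symmetry leaves `C` one diagonal and one off-diagonal value. Its rows sum to zero
  -- because `∑ E b = 1` and `Tr A = 0`; hence `C` is a multiple of `d δ_ab - 1`, which is the
  -- claimed quadratic form on diagonal `X`. Diagonalization handles the rest.
  let C (a b : d) : ℂ := ∫ U, conjTrace A (E a) U * conjTrace A (E b) U ∂(haarUnitary d)
  have hi (a b : d) : Integrable (fun U => conjTrace A (E a) U * conjTrace A (E b) U)
      (haarUnitary d) :=
    integrable_of_continuous_unitaryGroup ((continuous_conjTrace _ _).mul (continuous_conjTrace _ _))
  have hperm (σ : Equiv.Perm d) (a b : d) : C a b = C (σ a) (σ b) := by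
    have := integral_haarUnitary_conjTrace_mul_conj A (E (σ a)) (E (σ b)) (permUnitary σ)
    simp only [E] at this
    rwa [permUnitary_conj_single, permUnitary_conj_single] at this
  have hsum (a : d) : ∑ b, C a b = 0 := by
    simp only [C]
    rw [← integral_finsetSum _ fun b _ => hi a b]
    simp_rw [← Finset.mul_sum, ← conjTrace_sum, E, Matrix.sum_single_one, conjTrace_one_right, hA]
    simp
  obtain ⟨o⟩ : Nonempty d := inferInstance
  have hdiag (a : d) : C a a = C o o := by
    simpa using hperm (Equiv.swap a o) a a
  have hoff (a b c : d) (hb : b ≠ a) (hc : c ≠ a) : C a b = C a c := by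
    have := hperm (Equiv.swap b c) a b
    rwa [Equiv.swap_apply_left, Equiv.swap_apply_of_ne_of_ne hb.symm hc.symm] at this
  have hcard : ((Fintype.card d : ℂ) - 1) ≠ 0 := by
    have := Fintype.one_lt_card (α := d)
    rw [sub_ne_zero]
    exact_mod_cast this.ne'
  have hC (a b : d) : C a b = C o o / (Fintype.card d - 1) *
      ((if a = b then (Fintype.card d : ℂ) else 0) - 1) := by
    split_ifs with h
    · rw [← h, hdiag]
      field_simp
    · have h1 := hsum a
      rw [← Finset.add_sum_erase _ _ (Finset.mem_univ a),
        Finset.sum_congr rfl fun c hc => hoff a c b (Finset.ne_of_mem_erase hc) (Ne.symm h),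
        hdiag, Finset.sum_const, Finset.card_erase_of_mem (Finset.mem_univ a), Finset.card_univ,
        nsmul_eq_mul, Nat.cast_sub Fintype.card_pos, Nat.cast_one] at h1
      field_simp
      linear_combination h1
  generalize C o o / (Fintype.card d - 1) = γ at hC
  refine ⟨γ, fun X hX => ?_⟩
  obtain ⟨V, x, rfl⟩ := exists_unitary_conj_diagonal hX
  have htr (Y : Matrix d d ℂ) : (V.1 * Y * star V.1).trace = Y.trace := by
    rw [Matrix.trace_mul_comm, ← mul_assoc, Unitary.coe_star_mul_self, one_mul]
  have hmul : V.1 * Matrix.diagonal x * star V.1 * (V.1 * Matrix.diagonal x * star V.1) =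
      V.1 * (Matrix.diagonal x * Matrix.diagonal x) * star V.1 := by
    have : star V.1 * V.1 = 1 := Unitary.coe_star_mul_self V
    calc _ = V.1 * Matrix.diagonal x * (star V.1 * V.1) * Matrix.diagonal x * star V.1 := by
          simp only [mul_assoc]
      _ = _ := by rw [this, mul_one, mul_assoc V.1]
  rw [hmul, htr, htr, Matrix.diagonal_mul_diagonal, Matrix.trace_diagonal, Matrix.trace_diagonal]
  simp_rw [sq]
  rw [integral_haarUnitary_conjTrace_mul_conj, diagonal_eq_sum_smul_single]
  have hexp (U : Matrix.unitaryGroup d ℂ) :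
      conjTrace A (∑ a, x a • Matrix.single a a (1 : ℂ)) U *
        conjTrace A (∑ a, x a • Matrix.single a a (1 : ℂ)) U =
      ∑ a, ∑ b, x a * x b * (conjTrace A (E a) U * conjTrace A (E b) U) := by
    simp_rw [conjTrace_sum, conjTrace_smul, Finset.sum_mul_sum]
    refine Finset.sum_congr rfl fun a _ => Finset.sum_congr rfl fun b _ => ?_
    ring
  simp_rw [hexp]
  rw [integral_finsetSum _ fun a _ => integrable_finsetSum _ fun b _ => (hi a b).const_mul _]
  have hterm (a : d) : ∫ U, ∑ b, x a * x b * (conjTrace A (E a) U * conjTrace A (E b) U)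
      ∂(haarUnitary d) = ∑ b, x a * x b * C a b := by
    rw [integral_finsetSum _ fun b _ => (hi a b).const_mul _]
    simp_rw [integral_const_mul, C]
  simp_rw [hterm, hC, mul_sub, Finset.sum_mul_sum, Finset.mul_sum, Finset.sum_sub_distrib]
  congr 1
  · refine Finset.sum_congr rfl fun a _ => ?_
    rw [Finset.sum_eq_single a (fun b _ hb => by simp [hb.symm]) (by simp)]
    simp only [if_true]
    ring
  · refine Finset.sum_congr rfl fun a _ => Finset.sum_congr rfl fun b _ => ?_
    ring

/-- The second moment of `Tr(X U† A U)` under the Haar measure. -/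
lemma integral_haarUnitary_conjTrace_sq [Nontrivial d] {A X : Matrix d d ℂ}
    (hA : A.trace = 0) (hX : X.IsHermitian) :
    ∫ U, conjTrace A X U ^ 2 ∂(haarUnitary d) =
      (A * A).trace / (Fintype.card d ^ 2 - 1) *
        ((X * X).trace - X.trace ^ 2 / Fintype.card d) := by
  obtain ⟨γ, hγ⟩ := exists_integral_haarUnitary_conjTrace_sq (d := d) hA
  have hcard : (1 : ℝ) < Fintype.card d := by exact_mod_cast Fintype.one_lt_card (α := d)
  have hd : (Fintype.card d : ℂ) ≠ 0 := by
    exact_mod_cast (zero_lt_one.trans hcard).ne'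
  have hd2 : (Fintype.card d : ℂ) ^ 2 - 1 ≠ 0 := by
    have : ((Fintype.card d : ℝ) ^ 2 - 1) ≠ 0 := by nlinarith
    exact_mod_cast this
  -- To find `γ`, sum the invariant formula over a Hermitian spanning family. With `M = U† A U`, the
  -- squares for `R a b` and `J a b` add up to `M a b * M b a`, whose sum over `a, b` is `Tr(A²)`
  -- for every `U`.
  let R (a b : d) : Matrix d d ℂ := (1 / 2 : ℂ) • (Matrix.single a b 1 + Matrix.single b a 1)
  let J (a b : d) : Matrix d d ℂ :=
    (Complex.I / 2) • (Matrix.single a b 1 - Matrix.single b a 1)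
  have hR (a b : d) : (R a b).IsHermitian := by
    simp [R, Matrix.IsHermitian, add_comm]
  have hJ (a b : d) : (J a b).IsHermitian := by
    simp only [J, Matrix.IsHermitian, Matrix.conjTranspose_smul, Matrix.conjTranspose_sub,
      Matrix.conjTranspose_single, star_one]
    rw [← neg_sub, smul_neg, ← neg_smul]
    congr 1
    simp [neg_div]
  have hsq (U : Matrix.unitaryGroup d ℂ) :
      ∑ a, ∑ b, (conjTrace A (R a b) U ^ 2 + conjTrace A (J a b) U ^ 2) = (A * A).trace := by
    have h1 (a b : d) : conjTrace A (R a b) U ^ 2 + conjTrace A (J a b) U ^ 2 =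
        (star U.1 * A * U.1) a b * (star U.1 * A * U.1) b a := by
      have h2 (a b : d) : conjTrace A (Matrix.single a b 1) U = (star U.1 * A * U.1) b a := by
        simp [conjTrace, Matrix.trace_single_mul]
      have h3 : Matrix.single a b (1 : ℂ) - Matrix.single b a 1 =
        Matrix.single a b (1 : ℂ) + (-1 : ℂ) • Matrix.single b a 1 := by
        rw [neg_one_smul, sub_eq_add_neg]
      simp only [R, J, h3, conjTrace_smul, conjTrace_add, h2]
      ring_nf
      rw [Complex.I_sq]
      ring
    simp_rw [h1, ← Matrix.mul_apply]
    change ((star U.1 * A * U.1) * (star U.1 * A * U.1)).trace = _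
    have h4 : U.1 * star U.1 = 1 := Unitary.coe_mul_star_self U
    have h5 : (star U.1 * A * U.1) * (star U.1 * A * U.1) = star U.1 * (A * A) * U.1 := by
      calc _ = star U.1 * A * (U.1 * star U.1) * A * U.1 := by simp only [mul_assoc]
        _ = _ := by rw [h4, mul_one, mul_assoc (star U.1)]
    rw [h5, mul_assoc, Matrix.trace_mul_comm, mul_assoc, h4, mul_one]
  have hi (X : Matrix d d ℂ) : Integrable (fun U => conjTrace A X U ^ 2) (haarUnitary d) :=
    integrable_of_continuous_unitaryGroup ((continuous_conjTrace _ _).pow 2)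
  have hint : ∑ a, ∑ b, (∫ U, conjTrace A (R a b) U ^ 2 ∂(haarUnitary d) +
      ∫ U, conjTrace A (J a b) U ^ 2 ∂(haarUnitary d)) = (A * A).trace := by
    have h1 := integral_congr_ae (μ := haarUnitary d) (ae_of_all _ hsq)
    have hi2 (a b : d) : Integrable
        (fun U => conjTrace A (R a b) U ^ 2 + conjTrace A (J a b) U ^ 2) (haarUnitary d) :=
      (hi _).add (hi _)
    rw [integral_finsetSum _ fun a _ => integrable_finsetSum _ fun b _ => hi2 a b] at h1
    simp only [integral_const, probReal_univ, one_smul] at h1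
    rw [← h1]
    refine Finset.sum_congr rfl fun a _ => ?_
    rw [integral_finsetSum _ fun b _ => hi2 a b]
    exact Finset.sum_congr rfl fun b _ => (integral_add (hi _) (hi _)).symm
  have hval (a b : d) : ∫ U, conjTrace A (R a b) U ^ 2 ∂(haarUnitary d) +
      ∫ U, conjTrace A (J a b) U ^ 2 ∂(haarUnitary d) =
        γ * (Fintype.card d - if a = b then 1 else 0) := by
    rw [hγ _ (hR a b), hγ _ (hJ a b)]
    by_cases h : a = b
    · subst h
      have hRa : R a a = Matrix.single a a 1 := by
        rw [show R a a = (1 / 2 : ℂ) • (Matrix.single a a 1 + Matrix.single a a 1) from rfl,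
          ← two_smul ℂ, smul_smul]
        simp
      have hJa : J a a = 0 := by simp [J]
      rw [hRa, hJa]
      simp
    · have h' : b ≠ a := Ne.symm h
      simp [R, J, h, h', add_mul, mul_add, sub_mul, mul_sub,
        Matrix.trace_single_eq_of_ne]
      ring_nf
      rw [Complex.I_sq]
      ring
  -- Comparing the two sums gives `Tr(A²) = γ (d³ - d)`.
  simp_rw [hval, ← Finset.mul_sum, Finset.sum_sub_distrib] at hint
  simp at hint
  rw [hγ X hX, ← hint]
  field_simp

/-- A traceless observable has mean zero under a unitary 2-design. -/
lemma IsUnitaryTwoDesign.integral_conjTrace_eq_zero [Nonempty d]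
    {ν : ProbabilityMeasure (Matrix.unitaryGroup d ℂ)} (hν : IsUnitaryTwoDesign ν)
    {A X : Matrix d d ℂ} (hA : A.trace = 0) (hX : X.IsHermitian) :
    ∫ U, conjTrace A X U ∂(ν : Measure _) = 0 := by
  rw [hν.integral_conjTrace, integral_haarUnitary_conjTrace_eq_zero hA hX]

/-- The second moment of `Tr(X U† A U)` under a unitary 2-design. -/
lemma IsUnitaryTwoDesign.integral_conjTrace_sq [Nontrivial d]
    {ν : ProbabilityMeasure (Matrix.unitaryGroup d ℂ)} (hν : IsUnitaryTwoDesign ν)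
    {A X : Matrix d d ℂ} (hA : A.trace = 0) (hX : X.IsHermitian) :
    ∫ U, conjTrace A X U ^ 2 ∂(ν : Measure _) =
      (A * A).trace / (Fintype.card d ^ 2 - 1) *
        ((X * X).trace - X.trace ^ 2 / Fintype.card d) := by
  rw [← integral_haarUnitary_conjTrace_sq hA hX]
  simp_rw [sq]
  exact hν.integral_conjTrace_mul A X A X

end UnitaryMoments

/-! ### Tensor blocks, partial traces, and features as functions of reduced densities. -/

section BlockAlgebra

variable {m nQ : ℕ}

/-- A bit string of length `nQ * m` is the same as the family of its blocks. -/
def blockEquiv (nQ m : ℕ) : Bits (nQ * m) ≃ (Fin nQ → Bits m) :=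
  (finProdFinEquiv.arrowCongr (Equiv.refl _)).symm.trans (Equiv.curry _ _ _)

lemma blockEquiv_apply (x : Bits (nQ * m)) (k : Fin nQ) : blockEquiv nQ m x k = block k x := by
  ext j
  simp [blockEquiv, block, Function.curry]

/-- A bit string is a free choice of its blocks, so this is the distributive law. -/
lemma sum_prod_block (g : Fin nQ → Bits m → ℂ) :
    ∑ y : Bits (nQ * m), ∏ k, g k (block k y) = ∏ k, ∑ b, g k b := by
  rw [Finset.prod_univ_sum, Fintype.piFinset_univ, ← (blockEquiv nQ m).sum_comp]
  simp [blockEquiv_apply]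

lemma eq_of_block_eq {x y : Bits (nQ * m)} (h : ∀ k, block k x = block k y) : x = y :=
  (blockEquiv nQ m).injective (funext fun k => by simpa [blockEquiv_apply] using h k)

lemma tensorBlocks_mul (V W : Fin nQ → Matrix (Bits m) (Bits m) ℂ) :
    tensorBlocks V * tensorBlocks W = tensorBlocks fun k => V k * W k := by
  ext x y
  simp only [tensorBlocks, Matrix.mul_apply, Matrix.of_apply, ← Finset.prod_mul_distrib]
  exact sum_prod_block fun k b => V k (block k x) b * W k b (block k y)

lemma tensorBlocks_conjTranspose (V : Fin nQ → Matrix (Bits m) (Bits m) ℂ) :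
    (tensorBlocks V)ᴴ = tensorBlocks fun k => (V k)ᴴ := by
  ext x y
  simp [tensorBlocks, Matrix.conjTranspose_apply]

/-- Off block `k` each unitary meets its adjoint across an identity and cancels. -/
lemma tensorBlocks_conj_onBlock (U : Fin nQ → Matrix.unitaryGroup (Bits m) ℂ) (k : Fin nQ)
    (A : Matrix (Bits m) (Bits m) ℂ) :
    (tensorBlocks fun r => (U r).1)ᴴ * onBlock k A * tensorBlocks (fun r => (U r).1) =
      onBlock k (star (U k).1 * A * (U k).1) := by
  rw [onBlock, tensorBlocks_conjTranspose, tensorBlocks_mul, tensorBlocks_mul, onBlock]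
  congr 1
  funext r
  by_cases h : r = k
  · subst h
    simp [Matrix.star_eq_conjTranspose]
  · have hU : star (U r).1 * (U r).1 = 1 := Unitary.coe_star_mul_self (U r)
    simpa [h, Matrix.star_eq_conjTranspose] using hU

lemma onBlock_apply (k : Fin nQ) (M : Matrix (Bits m) (Bits m) ℂ) (x y : Bits (nQ * m)) :
    onBlock k M x y =
      if ∀ r, r ≠ k → block r x = block r y then M (block k x) (block k y) else 0 := by
  simp only [onBlock, tensorBlocks, Matrix.of_apply]
  rw [← Finset.mul_prod_erase _ _ (Finset.mem_univ k), Function.update_self]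
  have h : ∏ r ∈ Finset.univ.erase k,
      Function.update (fun _ => (1 : Matrix (Bits m) (Bits m) ℂ)) k M r (block r x) (block r y) =
      ∏ r ∈ Finset.univ.erase k, if block r x = block r y then (1 : ℂ) else 0 := by
    refine Finset.prod_congr rfl fun r hr => ?_
    rw [Function.update_of_ne (Finset.ne_of_mem_erase hr), Matrix.one_apply]
  rw [h, Finset.prod_ite_zero]
  simp

/-- The partial trace is dual to `onBlock` under the trace pairing: the indicator forces `a` and `b`
to be the `k`-th blocks of `x` and `y`. Local expectations thus see only the reduced density. -/
lemma partialTraceBlock_mul_trace (k : Fin nQ) (ρ : Matrix (Bits (nQ * m)) (Bits (nQ * m)) ℂ)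
    (M : Matrix (Bits m) (Bits m) ℂ) :
    (partialTraceBlock k ρ * M).trace = (ρ * onBlock k M).trace := by
  simp only [Matrix.trace, Matrix.diag, Matrix.mul_apply, partialTraceBlock, Matrix.of_apply,
    Finset.sum_mul, onBlock_apply]
  calc _ = ∑ a, ∑ x, ∑ b, ∑ y, (if block k x = a ∧ block k y = b ∧
        ∀ r, r ≠ k → block r x = block r y then ρ x y else 0) * M b a :=
        Finset.sum_congr rfl fun a _ => Finset.sum_comm
    _ = ∑ x, ∑ a, ∑ b, ∑ y, (if block k x = a ∧ block k y = b ∧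
        ∀ r, r ≠ k → block r x = block r y then ρ x y else 0) * M b a := Finset.sum_comm
    _ = _ := by
      refine Finset.sum_congr rfl fun x _ => ?_
      rw [Finset.sum_eq_single (block k x) (fun a _ ha => by simp [ha.symm]) (by simp),
        Finset.sum_comm]
      refine Finset.sum_congr rfl fun y _ => ?_
      rw [Finset.sum_eq_single (block k y) (fun a _ ha => by simp [ha.symm]) (by simp)]
      have : (∀ r, r ≠ k → block r y = block r x) ↔ (∀ r, r ≠ k → block r x = block r y) :=
        forall₂_congr fun _ _ => eq_comm
      simp [this]

lemma onBlock_one (k : Fin nQ) : onBlock k (1 : Matrix (Bits m) (Bits m) ℂ) = 1 := by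
  ext x y
  rw [onBlock_apply, Matrix.one_apply, Matrix.one_apply, ← ite_and]
  refine if_congr ⟨fun h => eq_of_block_eq fun r => ?_, fun h => by simp [h]⟩ rfl rfl
  by_cases hr : r = k
  · exact hr ▸ h.2
  · exact h.1 r hr

lemma partialTraceBlock_trace (k : Fin nQ) (ρ : Matrix (Bits (nQ * m)) (Bits (nQ * m)) ℂ) :
    (partialTraceBlock k ρ).trace = ρ.trace := by
  simpa [onBlock_one] using partialTraceBlock_mul_trace k ρ 1

lemma partialTraceBlock_isHermitian (k : Fin nQ) {ρ : Matrix (Bits (nQ * m)) (Bits (nQ * m)) ℂ}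
    (hρ : ρ.IsHermitian) : (partialTraceBlock k ρ).IsHermitian := by
  ext a b
  simp only [partialTraceBlock, Matrix.conjTranspose_apply, Matrix.of_apply, star_sum]
  rw [Finset.sum_comm]
  refine Finset.sum_congr rfl fun x _ => Finset.sum_congr rfl fun y _ => ?_
  rw [apply_ite star, star_zero, hρ.apply]
  refine if_congr ?_ rfl rfl
  have : (∀ r, r ≠ k → block r y = block r x) ↔ (∀ r, r ≠ k → block r x = block r y) :=
    forall₂_congr fun _ _ => eq_comm
  rw [this]
  tauto

lemma encodedDensity_eq {n : ℕ} (V : Matrix.unitaryGroup (Bits n) ℂ) :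
    encodedDensity V = Matrix.vecMulVec (encodedState V) (star (encodedState V)) := by
  rw [encodedDensity, encodedState, Matrix.mul_vecMulVec, Matrix.vecMulVec_mul,
    Matrix.star_mulVec]

lemma encodedDensity_isHermitian {n : ℕ} (V : Matrix.unitaryGroup (Bits n) ℂ) :
    (encodedDensity V).IsHermitian := by
  rw [encodedDensity_eq]
  ext x y
  simp [Matrix.vecMulVec_apply, mul_comm]

lemma encodedDensity_trace {n : ℕ} (V : Matrix.unitaryGroup (Bits n) ℂ) :
    (encodedDensity V).trace = 1 := by
  have h : star V.1 * V.1 = 1 := Unitary.coe_star_mul_self V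
  rw [encodedDensity, ← Matrix.star_eq_conjTranspose, Matrix.trace_mul_comm, ← mul_assoc, h,
    one_mul, Matrix.trace_vecMulVec]
  simp [zeroState]

lemma reducedDensity_isHermitian (V : Matrix.unitaryGroup (Bits (nQ * m)) ℂ) (k : Fin nQ) :
    (reducedDensity V k).IsHermitian :=
  partialTraceBlock_isHermitian k (encodedDensity_isHermitian V)

lemma reducedDensity_trace (V : Matrix.unitaryGroup (Bits (nQ * m)) ℂ) (k : Fin nQ) :
    (reducedDensity V k).trace = 1 :=
  (partialTraceBlock_trace k _).trans (encodedDensity_trace V)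

lemma star_dotProduct_mulVec_eq_trace {n : Type*} [Fintype n] (v : n → ℂ) (M : Matrix n n ℂ) :
    star v ⬝ᵥ (M *ᵥ v) = (Matrix.vecMulVec v (star v) * M).trace := by
  rw [Matrix.vecMulVec_mul, Matrix.trace_vecMulVec, Matrix.dotProduct_mulVec,
    dotProduct_comm]

lemma conj_conjTrace {d : Type} [Fintype d] [DecidableEq d] {A X : Matrix d d ℂ}
    (hA : A.IsHermitian) (hX : X.IsHermitian) (U : Matrix.unitaryGroup d ℂ) :
    star (conjTrace A X U) = conjTrace A X U := by
  rw [conjTrace, ← Matrix.trace_conjTranspose, Matrix.conjTranspose_mul,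
    Matrix.trace_mul_comm, hX.eq]
  congr 2
  simp [Matrix.star_eq_conjTranspose, Matrix.conjTranspose_mul, hA.eq, mul_assoc]

/-- The quantum feature is a sum of local terms that depend on the reduced densities. -/
lemma ofReal_quantumFeature {A : Matrix (Bits m) (Bits m) ℂ} (hA : A.IsHermitian)
    (V : Matrix.unitaryGroup (Bits (nQ * m)) ℂ) (U : Fin nQ → Matrix.unitaryGroup (Bits m) ℂ) :
    (quantumFeature A V U : ℂ) = ∑ k, conjTrace A (reducedDensity V k) (U k) := by
  have h : star (encodedState V) ⬝ᵥ
      (((tensorBlocks fun k => (U k).1)ᴴ * totalObservable nQ A * tensorBlocks fun k => (U k).1) *ᵥ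
        encodedState V) = ∑ k, conjTrace A (reducedDensity V k) (U k) := by
    rw [star_dotProduct_mulVec_eq_trace, ← encodedDensity_eq, totalObservable, Matrix.mul_sum,
      Matrix.sum_mul, Matrix.mul_sum, Matrix.trace_sum]
    refine Finset.sum_congr rfl fun k _ => ?_
    rw [tensorBlocks_conj_onBlock, conjTrace, reducedDensity, partialTraceBlock_mul_trace]
  rw [quantumFeature, h, ← Complex.conj_eq_iff_re, map_sum]
  exact Finset.sum_congr rfl fun k _ => conj_conjTrace hA (reducedDensity_isHermitian V k) (U k)

end BlockAlgebra

/-! ### Gaussian limits from characteristic functions, and a quantitative law of large numbers. -/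

section GaussianLimits

open scoped Topology

/-- Convergence to the centered Gaussian process `x ↦ ⟪v x, ξ⟫`, where `ξ` is a standard Gaussian
vector, follows from convergence of the characteristic functions of linear combinations. -/
lemma convergesToCenteredGaussianProcess_of_tendsto_charFun {X : Type*} {Ω : ℕ → Type*}
    [∀ N, MeasurableSpace (Ω N)] {f : (N : ℕ) → X → Ω N → ℝ} {P : (N : ℕ) → Measure (Ω N)}
    [∀ N, IsProbabilityMeasure (P N)] {S : X → X → ℝ} {J : Type} [Fintype J]
    (v : X → EuclideanSpace ℝ J) (hv : ∀ x x', inner ℝ (v x) (v x') = S x x')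
    (hf : ∀ N x, Measurable (f N x))
    (h : ∀ (I : Finset X) (t : I → ℝ),
      Tendsto (fun N => ∫ ω, Complex.exp ((∑ x : I, t x * f N x ω : ℝ) * Complex.I) ∂P N) atTop
        (𝓝 (Complex.exp (-(∑ x : I, ∑ x' : I, t x * t x' * S x x' : ℝ) / 2)))) :
    ConvergesToCenteredGaussianProcess f P S := by
  let E := EuclideanSpace ℝ J
  have hid : HasGaussianLaw (id : E → E) (stdGaussian E) :=
    ⟨by simpa using isGaussian_stdGaussian⟩
  refine ⟨E, inferInstance, stdGaussian E, inferInstance, fun x ω => inner ℝ (v x) ω,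
    ⟨fun I => ?_⟩, fun x => ?_, fun x x' => ?_, fun I => ?_⟩
  · exact hid.map (ContinuousLinearMap.pi fun x : I => innerSL ℝ (v x))
  · exact integral_strongDual_stdGaussian (innerSL ℝ (v x))
  · rw [← covarianceBilin_apply_eq_cov, covarianceBilin_stdGaussian, innerSL_apply_apply, hv]
    exact IsGaussian.memLp_two_id
  -- Lévy's continuity theorem is applied in `EuclideanSpace`, where `charFun` has its inner
  -- product; the continuous map `ofLp` carries the limit back to plain functions.
  · let Y (N : ℕ) (ω : Ω N) : EuclideanSpace ℝ I := WithLp.toLp 2 (I.restrict fun x => f N x ω)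
    let Z (ω : E) : EuclideanSpace ℝ I := WithLp.toLp 2 (I.restrict fun x => inner ℝ (v x) ω)
    have hY (N : ℕ) : Measurable (Y N) :=
      (WithLp.measurable_toLp 2 _).comp (measurable_pi_lambda _ fun x => hf N x)
    have hZ : Measurable Z :=
      (WithLp.measurable_toLp 2 _).comp (measurable_pi_lambda _ fun x =>
        (innerSL ℝ (v x)).continuous.measurable)
    have key : TendstoInDistribution Y atTop Z P (stdGaussian E) := by
      refine ⟨fun N => (hY N).aemeasurable, hZ.aemeasurable, ?_⟩
      refine ProbabilityMeasure.tendsto_of_tendsto_charFun fun t => ?_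
      simp only [ProbabilityMeasure.coe_mk]
      have hlim : charFun ((stdGaussian E).map Z) t =
          Complex.exp (-(∑ x : I, ∑ x' : I, t x * t x' * S x x' : ℝ) / 2) := by
        have h1 : charFun ((stdGaussian E).map Z) t =
            charFun (stdGaussian E) (∑ x : I, t x • v x) := by
          rw [charFun_apply, charFun_apply, integral_map hZ.aemeasurable (by fun_prop)]
          refine integral_congr_ae (ae_of_all _ fun ω => ?_)
          have h2 : inner ℝ (Z ω) t = inner ℝ ω (∑ x : I, t x • v x) := by
            rw [inner_sum, PiLp.inner_apply]
            refine Finset.sum_congr rfl fun x _ => ?_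
            rw [real_inner_smul_right, real_inner_comm (v x) ω]
            rfl
          simp only [h2]
        rw [h1, charFun_stdGaussian]
        congr 3
        rw [← Complex.ofReal_pow, ← real_inner_self_eq_norm_sq, sum_inner]
        congr 1
        refine Finset.sum_congr rfl fun x _ => ?_
        rw [inner_sum]
        refine Finset.sum_congr rfl fun x' _ => ?_
        rw [real_inner_smul_left, real_inner_smul_right, hv, mul_assoc]
      rw [hlim]
      refine (h I t.ofLp).congr fun N => ?_
      rw [charFun_apply, integral_map (hY N).aemeasurable (by fun_prop)]
      refine integral_congr_ae (ae_of_all _ fun ω => ?_)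
      have h2 : inner ℝ (Y N ω) t = ∑ x : I, t x * f N x ω := PiLp.inner_apply _ _
      simp only [h2]
    exact key.continuous_comp (PiLp.continuous_ofLp 2 _)

/-- For `b ≤ a ≤ 0`, write the difference as `e^a (1 - e^(b-a))` and use `e^a ≤ 1` and `1 + y ≤
e^y`. -/
lemma abs_exp_sub_exp_le {a b : ℝ} (ha : a ≤ 0) (hb : b ≤ 0) :
    |Real.exp a - Real.exp b| ≤ |a - b| := by
  wlog hab : b ≤ a generalizing a b
  · rw [abs_sub_comm, abs_sub_comm a]
    exact this hb ha (le_of_not_ge hab)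
  rw [abs_of_nonneg (sub_nonneg.2 (Real.exp_le_exp.2 hab)), abs_of_nonneg (sub_nonneg.2 hab)]
  have h1 := Real.add_one_le_exp (b - a)
  have h2 : Real.exp b = Real.exp a * Real.exp (b - a) := by rw [← Real.exp_add]; ring_nf
  have h3 : Real.exp a ≤ 1 := Real.exp_le_one_iff.2 ha
  have h4 := Real.exp_pos a
  rw [h2]
  nlinarith

/-- A quantitative weak law of large numbers for bounded independent variables with a common
mean. -/
lemma integral_pi_sq_mean_sub_le {G : Type*} [MeasurableSpace G] {μ : ℕ → Measure G}
    [∀ i, IsProbabilityMeasure (μ i)] {q : G → ℝ} (hq : Measurable q) {K c : ℝ}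
    (hK : ∀ u, |q u| ≤ K) (hc : ∀ i, ∫ u, q u ∂μ i = c) {n : ℕ} (hn : 0 < n) :
    ∫ u : Fin n → G, (1 / (n : ℝ) * ∑ i, q (u i) - c) ^ 2 ∂(Measure.pi fun i : Fin n => μ i) ≤
      K ^ 2 / n := by
  have hn' : (n : ℝ) ≠ 0 := by positivity
  have hL (i : ℕ) : MemLp q 2 (μ i) := MemLp.of_bound hq.aestronglyMeasurable K (ae_of_all _ hK)
  have hL' (i : Fin n) : MemLp (fun u : Fin n → G => q (u i)) 2
      (Measure.pi fun i : Fin n => μ i) :=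
    MemLp.of_bound (hq.comp (measurable_pi_apply i)).aestronglyMeasurable K
      (ae_of_all _ fun u => hK (u i))
  have hmean : ∫ u : Fin n → G, (∑ i, fun u : Fin n → G => q (u i)) u
      ∂(Measure.pi fun i : Fin n => μ i) = n * c := by
    simp only [Finset.sum_apply]
    rw [integral_finsetSum _ fun i _ => (hL' i).integrable (by norm_num)]
    have (i : Fin n) : ∫ u : Fin n → G, q (u i) ∂(Measure.pi fun i : Fin n => μ i) = c := by
      rw [integral_comp_eval (f := q) (i := i) (μ := fun i : Fin n => μ i)
        hq.aestronglyMeasurable, hc]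
    simp [this]
  -- The laws may differ: independence adds the variances, and each is at most `K ^ 2`.
  have hvar := variance_sum_pi (μ := fun i : Fin n => μ i) (X := fun _ => q) fun i => hL i
  rw [variance_eq_integral (by fun_prop), hmean] at hvar
  have hle (i : Fin n) : Var[q; μ i] ≤ K ^ 2 := by
    refine (variance_le_expectation_sq hq.aestronglyMeasurable).trans ?_
    have : ∀ u, (q ^ 2) u ≤ K ^ 2 := fun u => by
      simpa using sq_le_sq' (abs_le.1 (hK u)).1 (abs_le.1 (hK u)).2
    refine (integral_mono (hL i).integrable_sq (integrable_const _) this).trans ?_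
    simp
  calc _ = ∫ u : Fin n → G, (1 / (n : ℝ)) ^ 2 *
        ((∑ i, fun u : Fin n → G => q (u i)) u - n * c) ^ 2
          ∂(Measure.pi fun i : Fin n => μ i) := by
        refine integral_congr_ae (ae_of_all _ fun u => ?_)
        simp only [Finset.sum_apply]
        field_simp
    _ = (1 / (n : ℝ)) ^ 2 * ∑ i : Fin n, Var[q; μ i] := by rw [integral_const_mul, hvar]
    _ ≤ (1 / (n : ℝ)) ^ 2 * ∑ i : Fin n, K ^ 2 := by gcongr with i; exact hle i
    _ = _ := by
        simp
        field_simp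

/-- The average tends to `c` in mean square, and `s ↦ exp (-s / 2)` is Lipschitz on `s ≥ 0`. -/
lemma tendsto_integral_exp_neg_mean {G : Type*} [MeasurableSpace G] {μ : ℕ → Measure G}
    [∀ i, IsProbabilityMeasure (μ i)] {q : G → ℝ} (hq : Measurable q) {K c : ℝ}
    (hq0 : ∀ u, 0 ≤ q u) (hK : ∀ u, q u ≤ K) (hc : ∀ i, ∫ u, q u ∂μ i = c) :
    Tendsto (fun n : ℕ => ∫ u : Fin n → G, Real.exp (-(1 / (n : ℝ) * ∑ i, q (u i)) / 2)
      ∂(Measure.pi fun i : Fin n => μ i)) atTop (𝓝 (Real.exp (-c / 2))) := by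
  have hc0 : 0 ≤ c := hc 0 ▸ integral_nonneg hq0
  have hK' (u : G) : |q u| ≤ K := by rw [abs_of_nonneg (hq0 u)]; exact hK u
  rw [tendsto_iff_dist_tendsto_zero]
  have hlim : Tendsto (fun n : ℕ => (1 + K ^ 2) / 4 * (1 / √(n : ℝ))) atTop (𝓝 0) := by
    have : Tendsto (fun n : ℕ => 1 / √(n : ℝ)) atTop (𝓝 0) := by
      simp_rw [one_div]
      exact tendsto_inv_atTop_zero.comp (Real.tendsto_sqrt_atTop.comp tendsto_natCast_atTop_atTop)
    simpa using this.const_mul ((1 + K ^ 2) / 4)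
  refine squeeze_zero' (Eventually.of_forall fun _ => dist_nonneg) ?_ hlim
  filter_upwards [eventually_gt_atTop 0] with n hn
  set π := Measure.pi fun i : Fin n => μ i
  let s (u : Fin n → G) : ℝ := 1 / (n : ℝ) * ∑ i, q (u i)
  have hn' : (0 : ℝ) < n := by exact_mod_cast hn
  have hs : Measurable s := by fun_prop
  have hs0 (u : Fin n → G) : 0 ≤ s u :=
    mul_nonneg (by positivity) (Finset.sum_nonneg fun i _ => hq0 (u i))
  have hsK (u : Fin n → G) : s u ≤ K := by
    have : ∑ i, q (u i) ≤ n * K := by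
      simpa using Finset.sum_le_sum fun i (_ : i ∈ Finset.univ) => hK (u i)
    simp only [s]
    rw [one_div, inv_mul_le_iff₀ hn']
    exact this
  have hexp : Integrable (fun u => Real.exp (-s u / 2)) π :=
    Integrable.of_bound (by fun_prop) 1 (ae_of_all _ fun u => by
      rw [Real.norm_eq_abs, Real.abs_exp, Real.exp_le_one_iff]
      linarith [hs0 u])
  have hsq : Integrable (fun u => (s u - c) ^ 2) π :=
    Integrable.of_bound (by fun_prop) ((K + c) ^ 2) (ae_of_all _ fun u => by
      rw [Real.norm_eq_abs, abs_of_nonneg (sq_nonneg _)]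
      exact sq_le_sq' (by linarith [hs0 u, hsK u]) (by linarith [hsK u]))
  have hr : 0 < √(n : ℝ) := Real.sqrt_pos.2 hn'
  have hpt (u : Fin n → G) : |Real.exp (-s u / 2) - Real.exp (-c / 2)| ≤
      (1 / √(n : ℝ) + √(n : ℝ) * (s u - c) ^ 2) / 4 := by
    refine (abs_exp_sub_exp_le (by linarith [hs0 u]) (by linarith)).trans ?_
    have h1 : |-s u / 2 - -c / 2| = |s u - c| / 2 := by
      rw [show -s u / 2 - -c / 2 = -((s u - c) / 2) by ring, abs_neg, abs_div, abs_two]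
    -- Weighted AM-GM. Since the mean of `(s - c)²` is at most `K² / n`, the weight `√n` makes both
    -- terms of order `1 / √n`.
    have h2 : 2 * |s u - c| ≤ 1 / √(n : ℝ) + √(n : ℝ) * (s u - c) ^ 2 := by
      rw [← sq_abs (s u - c)]
      have h3 : 0 ≤ (√(n : ℝ) * |s u - c| - 1) ^ 2 / √(n : ℝ) := by positivity
      have h4 : (√(n : ℝ) * |s u - c| - 1) ^ 2 / √(n : ℝ) =
          1 / √(n : ℝ) + √(n : ℝ) * |s u - c| ^ 2 - 2 * |s u - c| := by
        field_simp
        ring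
      linarith
    rw [h1]
    linarith
  have hmain := integral_pi_sq_mean_sub_le hq hK' hc hn
  calc dist (∫ u, Real.exp (-s u / 2) ∂π) (Real.exp (-c / 2))
      = |∫ u, (Real.exp (-s u / 2) - Real.exp (-c / 2)) ∂π| := by
        rw [Real.dist_eq, integral_sub hexp (integrable_const _)]
        simp
    _ ≤ ∫ u, |Real.exp (-s u / 2) - Real.exp (-c / 2)| ∂π := abs_integral_le_integral_abs
    _ ≤ ∫ u, (1 / √(n : ℝ) + √(n : ℝ) * (s u - c) ^ 2) / 4 ∂π :=
        integral_mono (hexp.sub (integrable_const _)).abs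
          (((integrable_const _).add (hsq.const_mul _)).div_const _) hpt
    _ = (1 / √(n : ℝ) + √(n : ℝ) * ∫ u, (s u - c) ^ 2 ∂π) / 4 := by
        rw [integral_div, integral_add (integrable_const _) (hsq.const_mul _),
          integral_const_mul]
        simp
    _ ≤ (1 / √(n : ℝ) + √(n : ℝ) * (K ^ 2 / n)) / 4 := by gcongr
    _ = (1 + K ^ 2) / 4 * (1 / √(n : ℝ)) := by
        have h5 : √(n : ℝ) * (K ^ 2 / n) = K ^ 2 * (1 / √(n : ℝ)) := by
          field_simp
          rw [Real.sq_sqrt hn'.le, mul_comm]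
        rw [h5]
        ring

/-- The characteristic function of a linear combination of independent standard normal
variables. -/
lemma integral_exp_gaussian_prod {n : ℕ} (a : Fin n → ℝ) (β : ℝ) :
    ∫ p : (Fin n → ℝ) × ℝ, Complex.exp ((∑ i, a i * p.1 i + β * p.2 : ℝ) * Complex.I)
        ∂((Measure.pi fun _ => gaussianReal 0 1).prod (gaussianReal 0 1)) =
      (Real.exp (-(∑ i, a i ^ 2 + β ^ 2) / 2) : ℂ) := by
  have h1 (p : (Fin n → ℝ) × ℝ) :
      Complex.exp ((∑ i, a i * p.1 i + β * p.2 : ℝ) * Complex.I) =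
        (∏ i, Complex.exp (a i * p.1 i * Complex.I)) * Complex.exp (β * p.2 * Complex.I) := by
    rw [← Complex.exp_sum, ← Complex.exp_add, ← Finset.sum_mul, ← add_mul]
    push_cast
    rfl
  have h2 (b : ℝ) : ∫ x : ℝ, Complex.exp (b * x * Complex.I) ∂(gaussianReal 0 1) =
      Complex.exp (-b ^ 2 / 2) := by
    rw [← charFun_apply_real, charFun_gaussianReal]
    simp [neg_div]
  simp_rw [h1]
  rw [integral_prod_mul (fun w : Fin n → ℝ => ∏ i, Complex.exp (a i * w i * Complex.I))
    (fun x : ℝ => Complex.exp (β * x * Complex.I)),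
    integral_fintype_prod_eq_prod (fun i (x : ℝ) => Complex.exp (a i * x * Complex.I))]
  simp_rw [h2]
  rw [← Complex.exp_sum, ← Complex.exp_add]
  push_cast
  rw [← Finset.sum_div, Finset.sum_neg_distrib]
  congr 1
  ring

end GaussianLimits

/-! ### The one-layer network conditionally on its unitaries. -/

section Model

variable {m nQ : ℕ}

/-- The unitaries, the weights of one neuron of a one-layer network and its bias have the expected
product law. -/
lemma measurePreserving_initLaw (w : Fin (0 + 1 + 1) → ℕ)
    (ν : ℕ → Fin nQ → ProbabilityMeasure (Matrix.unitaryGroup (Bits m) ℂ)) (j : Fin (w 1)) :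
    MeasurePreserving (fun ω : Init m nQ w => (ω.1, (ω.2.1 0 j, ω.2.2 0 j))) (initLaw w ν)
      ((Measure.pi fun i : Fin (w 0) => Measure.pi fun k : Fin nQ => (ν i k : Measure _)).prod
        ((Measure.pi fun _ : Fin (w 0) => gaussianReal 0 1).prod (gaussianReal 0 1))) := by
  have hW := (measurePreserving_eval (fun _ : Fin (w 1) =>
      Measure.pi fun _ : Fin (w 0) => gaussianReal 0 1) j).comp
    (measurePreserving_eval (fun ℓ : Fin (0 + 1) => Measure.pi fun _ : Fin (w ℓ.succ) =>
      Measure.pi fun _ : Fin (w ℓ.castSucc) => gaussianReal 0 1) 0)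
  have hb := (measurePreserving_eval (fun _ : Fin (w 1) => gaussianReal 0 1) j).comp
    (measurePreserving_eval (fun ℓ : Fin (0 + 1) => Measure.pi fun _ : Fin (w ℓ.succ) =>
      gaussianReal 0 1) 0)
  exact (MeasurePreserving.id (Measure.pi fun i : Fin (w 0) =>
    Measure.pi fun k : Fin nQ =>
      (ν i k : Measure (Matrix.unitaryGroup (Bits m) ℂ)))).prod (hW.prod hb)

lemma output_one_layer {X : Type*} (w : Fin (0 + 1 + 1) → ℕ) (σ : ℝ → ℝ) (ξ : ℝ)
    (A : Matrix (Bits m) (Bits m) ℂ) (Uenc : X → Matrix.unitaryGroup (Bits (nQ * m)) ℂ)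
    (x : X) (ω : Init m nQ w) (j : Fin (w 1)) :
    output w σ ξ A Uenc x ω j =
      1 / √(w 0 : ℝ) * ∑ i : Fin (w 0), ω.2.1 0 j i * quantumFeature A (Uenc x) (ω.1 i) +
        ξ * ω.2.2 0 j := rfl

lemma continuous_quantumFeature {A : Matrix (Bits m) (Bits m) ℂ} (hA : A.IsHermitian)
    (V : Matrix.unitaryGroup (Bits (nQ * m)) ℂ) : Continuous (quantumFeature A V) := by
  have h : quantumFeature A V = fun U => (∑ k, conjTrace A (reducedDensity V k) (U k)).re :=
    funext fun U => by rw [← ofReal_quantumFeature hA V U, Complex.ofReal_re]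
  rw [h]
  exact Complex.continuous_re.comp (continuous_finsetSum _ fun k _ =>
    (continuous_conjTrace A _).comp (continuous_apply k))

/-- Makes the product σ-algebra on families of unitaries Borel, so that continuous features are
measurable. -/
instance instSecondCountableTopologyUnitaryGroup {d : Type} [Fintype d] [DecidableEq d] :
    SecondCountableTopology (Matrix.unitaryGroup d ℂ) :=
  haveI : SecondCountableTopology (Matrix d d ℂ) :=
    inferInstanceAs (SecondCountableTopology (d → d → ℂ))
  TopologicalSpace.Subtype.secondCountableTopology
    (Matrix.unitaryGroup d ℂ : Set (Matrix d d ℂ))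

lemma measurable_quantumFeature {A : Matrix (Bits m) (Bits m) ℂ} (hA : A.IsHermitian)
    (V : Matrix.unitaryGroup (Bits (nQ * m)) ℂ) : Measurable (quantumFeature A V) :=
  (continuous_quantumFeature hA V).measurable

/-- Conditionally on the unitaries, the outputs of a one-layer network are Gaussian. -/
lemma integral_exp_output {X : Type*} (w : Fin (0 + 1 + 1) → ℕ) (σ : ℝ → ℝ) (ξ : ℝ)
    {A : Matrix (Bits m) (Bits m) ℂ} (hA : A.IsHermitian)
    (Uenc : X → Matrix.unitaryGroup (Bits (nQ * m)) ℂ)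
    (ν : ℕ → Fin nQ → ProbabilityMeasure (Matrix.unitaryGroup (Bits m) ℂ)) (j : Fin (w 1))
    (I : Finset X) (t : I → ℝ) :
    ∫ ω, Complex.exp ((∑ x : I, t x * output w σ ξ A Uenc x ω j : ℝ) * Complex.I)
        ∂(initLaw w ν) =
      (((∫ u : Fin (w 0) → Fin nQ → Matrix.unitaryGroup (Bits m) ℂ,
        Real.exp (-(1 / (w 0 : ℝ) * ∑ i, (∑ x : I, t x * quantumFeature A (Uenc x) (u i)) ^ 2) / 2)
          ∂(Measure.pi fun i : Fin (w 0) => Measure.pi fun k => (ν i k : Measure _))) *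
        Real.exp (-(ξ * ∑ x, t x) ^ 2 / 2) : ℝ) : ℂ) := by
  let q (U : Fin nQ → Matrix.unitaryGroup (Bits m) ℂ) : ℝ :=
    ∑ x : I, t x * quantumFeature A (Uenc x) U
  have hq : Measurable q :=
    Finset.measurable_sum _ fun x _ => (measurable_quantumFeature hA _).const_mul _
  -- Regrouped by Gaussian variable: weight `i` has coefficient `q (u i) / √n₀`, and the bias,
  -- shared by all inputs, has `ξ ∑ t`.
  let F (p : (Fin (w 0) → Fin nQ → Matrix.unitaryGroup (Bits m) ℂ) × ((Fin (w 0) → ℝ) × ℝ)) : ℂ :=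
    Complex.exp ((∑ i, (1 / √(w 0 : ℝ) * q (p.1 i)) * p.2.1 i + (ξ * ∑ x, t x) * p.2.2 : ℝ) *
      Complex.I)
  have hF : Measurable F := by
    have : Measurable fun p : (Fin (w 0) → Fin nQ → Matrix.unitaryGroup (Bits m) ℂ) ×
        ((Fin (w 0) → ℝ) × ℝ) =>
        ∑ i, (1 / √(w 0 : ℝ) * q (p.1 i)) * p.2.1 i + (ξ * ∑ x, t x) * p.2.2 := by fun_prop
    fun_prop
  have h1 (ω : Init m nQ w) :
      Complex.exp ((∑ x : I, t x * output w σ ξ A Uenc x ω j : ℝ) * Complex.I) =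
        F (ω.1, (ω.2.1 0 j, ω.2.2 0 j)) := by
    simp only [F, q]
    congr 3
    simp only [output_one_layer, mul_add, Finset.sum_add_distrib, Finset.mul_sum, Finset.sum_mul]
    rw [Finset.sum_comm]
    congr 1
    · refine Finset.sum_congr rfl fun i _ => Finset.sum_congr rfl fun x _ => ?_
      ring
    · refine Finset.sum_congr rfl fun x _ => ?_
      ring
  have hval : ∫ p, F p ∂((Measure.pi fun i : Fin (w 0) =>
      Measure.pi fun k : Fin nQ => (ν i k : Measure (Matrix.unitaryGroup (Bits m) ℂ))).prod
        ((Measure.pi fun _ : Fin (w 0) => gaussianReal 0 1).prod (gaussianReal 0 1))) =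
      (((∫ u : Fin (w 0) → Fin nQ → Matrix.unitaryGroup (Bits m) ℂ,
        Real.exp (-(1 / (w 0 : ℝ) * ∑ i, q (u i) ^ 2) / 2)
          ∂(Measure.pi fun i : Fin (w 0) => Measure.pi fun k => (ν i k : Measure _))) *
        Real.exp (-(ξ * ∑ x, t x) ^ 2 / 2) : ℝ) : ℂ) := by
    -- Fubini, with the Gaussian variables integrated first.
    rw [integral_prod]
    · simp only [F]
      simp_rw [integral_exp_gaussian_prod]
      rw [integral_complex_ofReal, ← integral_mul_const]
      congr 1
      refine integral_congr_ae (ae_of_all _ fun u => ?_)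
      simp only
      rw [← Real.exp_add]
      congr 1
      have h2 : ∑ i, (1 / √(w 0 : ℝ) * q (u i)) ^ 2 = 1 / (w 0 : ℝ) * ∑ i, q (u i) ^ 2 := by
        rw [Finset.mul_sum]
        refine Finset.sum_congr rfl fun i _ => ?_
        rw [mul_pow, div_pow, Real.sq_sqrt (Nat.cast_nonneg _), one_pow]
      rw [h2]
      ring
    · refine Integrable.of_bound hF.aestronglyMeasurable 1 (ae_of_all _ fun p => ?_)
      simp only [F]
      rw [Complex.norm_exp_ofReal_mul_I]
  have hmp := measurePreserving_initLaw w ν j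
  simp_rw [h1]
  rw [← integral_map (f := F) hmp.measurable.aemeasurable hF.aestronglyMeasurable, hmp.map_eq]
  exact hval

end Model

/-! ### Second moments of sums over independent blocks. -/

section SecondMoment

lemma ofReal_re_trace_mul {d : Type} [Fintype d] {A B : Matrix d d ℂ} (hA : A.IsHermitian)
    (hB : B.IsHermitian) : (((A * B).trace.re : ℝ) : ℂ) = (A * B).trace := by
  rw [← Complex.conj_eq_iff_re]
  change star _ = _
  rw [← Matrix.trace_conjTranspose, Matrix.conjTranspose_mul, hA.eq, hB.eq, Matrix.trace_mul_comm]

/-- Writes the trace pairing as a real Euclidean inner product, which gives both `Tr(A²) ≥ 0` and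
the Gram form of the kernel. -/
lemma re_trace_mul_eq_sum {d : Type} [Fintype d] (A : Matrix d d ℂ) {B : Matrix d d ℂ}
    (hB : B.IsHermitian) :
    (A * B).trace.re = ∑ a, ∑ b, ((A a b).re * (B a b).re + (A a b).im * (B a b).im) := by
  simp only [Matrix.trace, Matrix.diag, Matrix.mul_apply, Complex.re_sum]
  refine Finset.sum_congr rfl fun a _ => Finset.sum_congr rfl fun b _ => ?_
  rw [← hB.apply b a]
  simp

lemma isHermitian_sum_real_smul {d ι : Type*} [Fintype ι] {t : ι → ℝ} {R : ι → Matrix d d ℂ}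
    (hR : ∀ x, (R x).IsHermitian) : (∑ x, (t x : ℂ) • R x).IsHermitian := by
  simp only [Matrix.IsHermitian, Matrix.conjTranspose_sum, Matrix.conjTranspose_smul]
  exact Finset.sum_congr rfl fun x _ => by rw [(hR x).eq]; simp

variable {d : Type} [Fintype d] [DecidableEq d] [Nontrivial d]

/-- The second moment of a real linear combination of local features under a product of unitary
2-designs. -/
lemma integral_pi_sq_sum_re_conjTrace {κ : Type*} [Fintype κ]
    {ν : κ → ProbabilityMeasure (Matrix.unitaryGroup d ℂ)} (hν : ∀ k, IsUnitaryTwoDesign (ν k))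
    {A : Matrix d d ℂ} (hA : A.IsHermitian) (hA0 : A.trace = 0) {R : κ → Matrix d d ℂ}
    (hR : ∀ k, (R k).IsHermitian) :
    ∫ U : κ → Matrix.unitaryGroup d ℂ, (∑ k, (conjTrace A (R k) (U k)).re) ^ 2
        ∂(Measure.pi fun k => (ν k : Measure _)) =
      (A * A).trace.re / (Fintype.card d ^ 2 - 1) *
        ∑ k, ((R k * R k).trace.re - (R k).trace.re ^ 2 / Fintype.card d) := by
  let g (k : κ) (U : Matrix.unitaryGroup d ℂ) : ℝ := (conjTrace A (R k) U).re
  have hg (k : κ) : Continuous (g k) := Complex.continuous_re.comp (continuous_conjTrace _ _)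
  have hgc (k : κ) (U : Matrix.unitaryGroup d ℂ) : (g k U : ℂ) = conjTrace A (R k) U :=
    Complex.conj_eq_iff_re.1 (conj_conjTrace hA (hR k) U)
  have hgi (k : κ) : Integrable (g k) (ν k : Measure _) :=
    integrable_of_continuous_unitaryGroup (hg k)
  have hg2 (k : κ) : MemLp (g k) 2 (ν k : Measure _) :=
    (memLp_two_iff_integrable_sq (hgi k).aestronglyMeasurable).2
      (integrable_of_continuous_unitaryGroup ((hg k).pow 2))
  have hg0 (k : κ) : ∫ U, g k U ∂(ν k : Measure _) = 0 := by
    rw [← Complex.ofReal_inj, ← integral_complex_ofReal]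
    simp_rw [hgc]
    rw [(hν k).integral_conjTrace_eq_zero hA0 (hR k), Complex.ofReal_zero]
  have htr (k : κ) : (((R k).trace.re : ℝ) : ℂ) = (R k).trace := by
    simpa using ofReal_re_trace_mul (hR k) Matrix.isHermitian_one
  have hgs (k : κ) : ∫ U, g k U ^ 2 ∂(ν k : Measure _) =
      (A * A).trace.re / (Fintype.card d ^ 2 - 1) *
        ((R k * R k).trace.re - (R k).trace.re ^ 2 / Fintype.card d) := by
    rw [← Complex.ofReal_inj, ← integral_complex_ofReal]
    push_cast
    simp_rw [hgc]
    rw [(hν k).integral_conjTrace_sq hA0 (hR k), ofReal_re_trace_mul hA hA,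
      ofReal_re_trace_mul (hR k) (hR k), htr]
  have hmean : ∫ U : κ → Matrix.unitaryGroup d ℂ, (∑ k, fun U : κ → Matrix.unitaryGroup d ℂ =>
      g k (U k)) U ∂(Measure.pi fun k => (ν k : Measure _)) = 0 := by
    simp only [Finset.sum_apply]
    rw [integral_finsetSum _ fun k _ => integrable_comp_eval (X := fun _ : κ =>
      Matrix.unitaryGroup d ℂ) (μ := fun k => (ν k : Measure _)) (i := k) (f := g k) (hgi k)]
    refine Finset.sum_eq_zero fun k _ => ?_
    rw [integral_comp_eval (X := fun _ : κ => Matrix.unitaryGroup d ℂ)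
      (μ := fun k => (ν k : Measure _)) (i := k) (f := g k) (hgi k).aestronglyMeasurable, hg0]
  -- The block terms are independent and centered, so second moments are variances and cross terms
  -- vanish.
  have hvar := variance_sum_pi (μ := fun k => (ν k : Measure _)) (X := g) hg2
  rw [variance_of_integral_eq_zero _ hmean] at hvar
  · rw [Finset.mul_sum]
    calc _ = ∑ k, Var[g k; (ν k : Measure _)] := by rw [← hvar]; simp [g]
      _ = _ := Finset.sum_congr rfl fun k _ => by
        rw [variance_of_integral_eq_zero (hgi k).aemeasurable (hg0 k), hgs]
  · exact Finset.aemeasurable_sum _ fun k _ =>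
      ((hg k).measurable.comp (measurable_pi_apply k)).aemeasurable

end SecondMoment

/-! ### The covariance function as a Gram matrix and as a second moment. -/

section Covariance

variable {m nQ : ℕ} {X : Type*}

/-- A feature vector whose Gram matrix is the covariance function: the real and imaginary parts
of the entries of the centered reduced densities, and the bias scale. -/
def covarianceFeature (A : Matrix (Bits m) (Bits m) ℂ)
    (Uenc : X → Matrix.unitaryGroup (Bits (nQ * m)) ℂ) (ξ : ℝ) (x : X) :
    EuclideanSpace ℝ ((Fin nQ × Bits m × Bits m) ⊕ (Fin nQ × Bits m × Bits m) ⊕ Unit) :=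
  WithLp.toLp 2 (Sum.elim
    (fun p => √((A * A).trace.re / (2 ^ (2 * m) - 1)) *
      ((reducedDensity (Uenc x) p.1 - (1 / 2 ^ m : ℂ) • 1) p.2.1 p.2.2).re)
    (Sum.elim
      (fun p => √((A * A).trace.re / (2 ^ (2 * m) - 1)) *
        ((reducedDensity (Uenc x) p.1 - (1 / 2 ^ m : ℂ) • 1) p.2.1 p.2.2).im)
      (fun _ => ξ)))

/-- Subtracting `1 / 2 ^ m` times the identity from two densities of trace one lowers the trace of
their product by exactly `1 / 2 ^ m`. -/
lemma inner_covarianceFeature {A : Matrix (Bits m) (Bits m) ℂ} (hA : A.IsHermitian)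
    (Uenc : X → Matrix.unitaryGroup (Bits (nQ * m)) ℂ) (ξ : ℝ) (x x' : X) :
    inner ℝ (covarianceFeature A Uenc ξ x) (covarianceFeature A Uenc ξ x') =
      covarianceKernel A Uenc ξ x x' := by
  let r (x : X) (k : Fin nQ) : Matrix (Bits m) (Bits m) ℂ :=
    reducedDensity (Uenc x) k - (1 / 2 ^ m : ℂ) • 1
  have hr (x : X) (k : Fin nQ) : (r x k).IsHermitian := by
    refine (reducedDensity_isHermitian _ _).sub ?_
    simp [Matrix.IsHermitian, Matrix.conjTranspose_smul]
  -- Needed to square the root in the feature vector. For `m = 0` the denominator vanishes and the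
  -- quotient is `0` by convention.
  have hβ : 0 ≤ (A * A).trace.re / (2 ^ (2 * m) - 1) := by
    refine div_nonneg ?_ (sub_nonneg.2 (one_le_pow₀ one_le_two))
    rw [re_trace_mul_eq_sum A hA]
    exact Finset.sum_nonneg fun a _ => Finset.sum_nonneg fun b _ =>
      add_nonneg (mul_self_nonneg _) (mul_self_nonneg _)
  have hrr (k : Fin nQ) : (r x k * r x' k).trace =
      (reducedDensity (Uenc x) k * reducedDensity (Uenc x') k).trace - 1 / 2 ^ m := by
    simp only [r, sub_mul, mul_sub, Matrix.trace_sub, Matrix.smul_mul, Matrix.mul_smul, one_mul,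
      mul_one, Matrix.trace_smul, reducedDensity_trace, Matrix.trace_one]
    simp
  rw [PiLp.inner_apply, Fintype.sum_sum_type, Fintype.sum_sum_type, covarianceKernel]
  simp only [covarianceFeature, Sum.elim_inl, Sum.elim_inr, Fintype.sum_prod_type,
    Finset.univ_unique, Finset.sum_singleton, RCLike.inner_apply, conj_trivial]
  rw [← add_assoc, ← Finset.sum_add_distrib, Finset.mul_sum, sq]
  congr 1
  refine Finset.sum_congr rfl fun k _ => ?_
  have h1 : (reducedDensity (Uenc x) k * reducedDensity (Uenc x') k).trace.re - 1 / 2 ^ m =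
      (r x k * r x' k).trace.re := by
    rw [hrr, Complex.sub_re]
    congr 1
    rw [← Complex.ofReal_re (1 / 2 ^ m)]
    push_cast
    rfl
  rw [h1, re_trace_mul_eq_sum _ (hr x' k), ← Finset.sum_add_distrib, Finset.mul_sum]
  refine Finset.sum_congr rfl fun a _ => ?_
  rw [← Finset.sum_add_distrib, Finset.mul_sum]
  refine Finset.sum_congr rfl fun b _ => ?_
  simp only [r]
  linear_combination
    (((reducedDensity (Uenc x) k - (1 / 2 ^ m : ℂ) • 1) a b).re *
        ((reducedDensity (Uenc x') k - (1 / 2 ^ m : ℂ) • 1) a b).re +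
      ((reducedDensity (Uenc x) k - (1 / 2 ^ m : ℂ) • 1) a b).im *
        ((reducedDensity (Uenc x') k - (1 / 2 ^ m : ℂ) • 1) a b).im) * Real.mul_self_sqrt hβ

/-- The second moment of a linear combination of quantum features, in terms of the covariance
function. -/
lemma integral_sq_sum_quantumFeature (hm : 0 < m) {A : Matrix (Bits m) (Bits m) ℂ}
    (hA : A.IsHermitian) (hA0 : A.trace = 0)
    (Uenc : X → Matrix.unitaryGroup (Bits (nQ * m)) ℂ) (ξ : ℝ)
    {ν : Fin nQ → ProbabilityMeasure (Matrix.unitaryGroup (Bits m) ℂ)}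
    (hν : ∀ k, IsUnitaryTwoDesign (ν k)) (I : Finset X) (t : I → ℝ) :
    ∫ U, (∑ x : I, t x * quantumFeature A (Uenc x) U) ^ 2
        ∂(Measure.pi fun k => (ν k : Measure _)) =
      ∑ x : I, ∑ x' : I, t x * t x' * covarianceKernel A Uenc ξ x x' - (ξ * ∑ x, t x) ^ 2 := by
  -- Makes `Bits m` nontrivial, as the second-moment formula requires.
  have : Nonempty (Fin m) := ⟨⟨0, hm⟩⟩
  -- Features are linear in the densities, so the combination is one feature with the Hermitian
  -- matrices `R k`, of trace `∑ t`, as densities.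
  let R (k : Fin nQ) : Matrix (Bits m) (Bits m) ℂ :=
    ∑ x : I, (t x : ℂ) • reducedDensity (Uenc x) k
  have hR (k : Fin nQ) : (R k).IsHermitian :=
    isHermitian_sum_real_smul fun x => reducedDensity_isHermitian _ _
  have hfeat (U : Fin nQ → Matrix.unitaryGroup (Bits m) ℂ) :
      ∑ x : I, t x * quantumFeature A (Uenc x) U = ∑ k, (conjTrace A (R k) (U k)).re := by
    rw [← Complex.re_sum, ← Complex.ofReal_re (∑ x : I, _)]
    congr 1
    push_cast
    simp_rw [ofReal_quantumFeature hA, R, conjTrace_sum, conjTrace_smul, Finset.mul_sum]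
    exact Finset.sum_comm
  have hcard : (Fintype.card (Bits m) : ℝ) = 2 ^ m := by simp
  simp_rw [hfeat]
  rw [integral_pi_sq_sum_re_conjTrace hν hA hA0 hR, hcard]
  have htr (k : Fin nQ) : (R k).trace.re = ∑ x, t x := by
    simp [R, Matrix.trace_sum, reducedDensity_trace]
  have htr2 (k : Fin nQ) : (R k * R k).trace.re = ∑ x : I, ∑ x' : I, t x * t x' *
      (reducedDensity (Uenc x) k * reducedDensity (Uenc x') k).trace.re := by
    simp only [R, Finset.sum_mul_sum, Matrix.trace_sum, Complex.re_sum, Matrix.smul_mul,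
      Matrix.mul_smul, Matrix.trace_smul, smul_eq_mul, Complex.re_ofReal_mul]
    exact Finset.sum_congr rfl fun x _ => Finset.sum_congr rfl fun x' _ => by ring
  have hsq : (∑ x, t x) ^ 2 = ∑ x, ∑ x', t x * t x' := by rw [sq, Finset.sum_mul_sum]
  have hβ : ((2 : ℝ) ^ m) ^ 2 = 2 ^ (2 * m) := by rw [← pow_mul, mul_comm]
  have hk (k : Fin nQ) : (R k * R k).trace.re - (R k).trace.re ^ 2 / 2 ^ m =
      ∑ x : I, ∑ x' : I, t x * t x' *
        ((reducedDensity (Uenc x) k * reducedDensity (Uenc x') k).trace.re - 1 / 2 ^ m) := by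
    rw [htr, htr2, hsq]
    simp only [mul_sub, Finset.sum_sub_distrib, Finset.sum_div, mul_one_div]
  simp_rw [hk, covarianceKernel, mul_pow, hsq, hβ, mul_add, Finset.sum_add_distrib]
  have hξ : ∑ x, ∑ x', t x * t x' * ξ ^ 2 = ξ ^ 2 * ∑ x, ∑ x', t x * t x' := by
    simp_rw [← Finset.sum_mul]
    ring
  rw [hξ, add_sub_cancel_right, Finset.sum_comm, Finset.mul_sum]
  refine Finset.sum_congr rfl fun x _ => ?_
  rw [Finset.sum_comm, Finset.mul_sum]
  refine Finset.sum_congr rfl fun x' _ => ?_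
  rw [← Finset.mul_sum]
  ring

end Covariance

end

end QCNN

theorem theorem3 {X : Type*} {m nQ : ℕ} (hm : 0 < m)
    (σ : ℝ → ℝ) (hσ : ∃ K, LipschitzWith K σ) (ξ : ℝ)
    (Uenc : X → Matrix.unitaryGroup (QCNN.Bits (nQ * m)) ℂ)
    (A : Matrix (QCNN.Bits m) (QCNN.Bits m) ℂ) (hA : A.IsHermitian) (hA0 : A.trace = 0)
    (ν : ℕ → Fin nQ → ProbabilityMeasure (Matrix.unitaryGroup (QCNN.Bits m) ℂ))
    (hν : ∀ i k, QCNN.IsUnitaryTwoDesign (ν i k)) :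
    QCNN.ConvergesToCenteredGaussianProcess
      (fun n₀ x ω => QCNN.output ![n₀, 1] σ ξ A Uenc x ω (0 : Fin 1))
      (fun n₀ => QCNN.initLaw ![n₀, 1] ν)
      (QCNN.covarianceKernel A Uenc ξ) := by
  refine QCNN.convergesToCenteredGaussianProcess_of_tendsto_charFun
    (QCNN.covarianceFeature A Uenc ξ) (QCNN.inner_covarianceFeature hA Uenc ξ)
    (fun n₀ x => ?_) fun I t => ?_
  · have hq := QCNN.measurable_quantumFeature hA (Uenc x)
    have h : Measurable fun p : (Fin n₀ → Fin nQ → Matrix.unitaryGroup (QCNN.Bits m) ℂ) ×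
        ((Fin n₀ → ℝ) × ℝ) => 1 / √(n₀ : ℝ) * ∑ i : Fin n₀,
          p.2.1 i * QCNN.quantumFeature A (Uenc x) (p.1 i) + ξ * p.2.2 := by
      fun_prop
    exact h.comp (QCNN.measurePreserving_initLaw ![n₀, 1] ν (0 : Fin 1)).measurable
  · let q (U : Fin nQ → Matrix.unitaryGroup (QCNN.Bits m) ℂ) : ℝ :=
      ∑ x : I, t x * QCNN.quantumFeature A (Uenc x) U
    have hq : Continuous q :=
      continuous_finsetSum _ fun x _ => (QCNN.continuous_quantumFeature hA _).const_mul _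
    -- A product of unitary groups is compact, so one bound serves all circuits.
    obtain ⟨K, hK⟩ := (isCompact_range (hq.pow 2)).bddAbove
    have hlim := QCNN.tendsto_integral_exp_neg_mean
      (μ := fun i => Measure.pi fun k => (ν i k : Measure _)) (hq.pow 2).measurable
      (fun U => sq_nonneg (q U)) (fun U => hK ⟨U, rfl⟩)
      (fun i => QCNN.integral_sq_sum_quantumFeature hm hA hA0 Uenc ξ (hν i) I t)
    have hlim' := (Complex.continuous_ofReal.tendsto _).comp
      (hlim.mul_const (Real.exp (-(ξ * ∑ x, t x) ^ 2 / 2)))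
    -- The bias factor restores the term `(ξ ∑ t)²` missing from the second moment of the features.
    rw [← Real.exp_add] at hlim'
    refine (hlim'.congr fun n₀ => ?_).trans (le_of_eq ?_)
    · exact (QCNN.integral_exp_output ![n₀, 1] σ ξ hA Uenc ν (0 : Fin 1) I t).symm
    · congr 1
      push_cast
      congr 1
      ring
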